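/- **Theorem 5.3.** Let $M$ be a nonempty smooth manifold (Hausdorff, second countable, without boundary) of dimension $2n+1$ with $n\ge 1$, and let $(\phi,\xi,\eta,g)$ be a Sasakian structure on $M$: a smooth $(1,1)$-tensor $\phi$, a smooth vector field $\xi$, a smooth one-form $\eta$ and a Riemannian metric $g$ with $$\eta(\xi)=1,\quad \phi^2=-I+\eta\otimes\xi,\quad g(\phi X,\phi Y)=g(X,Y)-\eta(X)\eta(Y),\quad d\eta(X,Y)=2g(X,\phi Y),\quad [\phi,\phi]+d\eta\otimes\xi=0,$$ where $d\eta(X,Y)=X\eta(Y)-Y\eta(X)-\eta([X,Y])$ and $[\phi,\phi](X,Y)=\phi^2[X,Y]+[\phi X,\phi Y]-\phi[\phi X,Y]-\phi[X,\phi Y]$. On $TM\oplus T^*M$ put $$\Phi=\begin{pmatrix}\phi&0\\0&-\phi^*\end{pmatrix},\qquad E_+=\xi,\qquad E_-=\eta,\qquad G=\begin{pmatrix}0&g^{-1}\\g&0\end{pmatrix},\qquad \phi^*\alpha=\alpha\circ\phi .$$ Then $(M,\Phi,E_+,E_-,G)$ is generalized Sasakian, that is, the following three statements hold. 1. It is a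 normal generalized contact metric structure. Let $\langle X+\alpha,Y+\beta\rangle=\frac12(\beta(X)+\alpha(Y))$, let $(A\otimes B)(v)=2\langle A,v\rangle B$, and let $[[X+\alpha,Y+\beta]]=[X,Y]+\mathcal L_X\beta-\mathcal L_Y\alpha-\frac12 d(\iota_X\beta-\iota_Y\alpha)$ be the Courant bracket. Then $\Phi$, $E_\pm$ and $G$ are smooth, and $$\Phi+\Phi^*=0,\quad \Phi^2=-I+E_+\otimes E_-+E_-\otimes E_+,\quad \langle E_\pm,E_\pm\rangle=0,\quad 2\langle E_+,E_-\rangle=1.$$ With $E^{(1,0)}$ the $\sqrt{-1}$-eigenbundle of $\Phi$ in $(TM\oplus T^*M)\otimes\mathbb C$ and $L_{E_\pm}$ the complex line bundle spanned by $E_\pm$, both $L_{E_+}\oplus E^{(1,0)}$ and $L_{E_-}\oplus E^{(1,0)}$ are closed under the Courant bracket (extended complex bilinearly), and $[[E_+,E_-]]=0$. Finally $$G^*=G,\quad G^2=I,\quad \langle Gv,v\rangle>0\ (v\ne0),\quad -\Phi G\Phi=G-E_+\otimes E_+-E_-\otimes E_- .$$ 2. $d(pr_{T^*M}E_++pr_{T^*M}E_-)=d\eta$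 is not identically zero. 3. Let $\pi_M=\pi_0+e_+\wedge e_-$ be the canonical Poisson structure, where $e_\pm=pr_{TM}E_\pm$ and $\pi_0:T^*M\to TM$ is the bivector $\alpha\mapsto pr_{TM}(\Phi\alpha)$ underlying $\Phi$, and regard $d\eta$ as the map $TM\to T^*M$, $v\mapsto\iota_v d\eta$. Then $I+e^t\,d\eta\,\pi_M:T^*M\to T^*M$ is invertible for every $t\in\mathbb R$. -/

import Mathlib

open Set Bundle Manifold
open scoped ContDiff

noncomputable section

namespace GenGeom

variable {E : Type*} [NormedAddCommGroup E] [NormedSpace ℝ E]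
  {M : Type*} [TopologicalSpace M] [ChartedSpace E M] [IsManifold 𝓘(ℝ, E) ∞ M]

/-! ### Vector fields, one-forms and sections of the big tangent bundle -/

/-- The tangent space of `M` (a manifold modelled on `E`) at `x`. -/
abbrev Tan (E : Type*) [NormedAddCommGroup E] [NormedSpace ℝ E]
    {M : Type*} [TopologicalSpace M] [ChartedSpace E M] (x : M) : Type _ :=
  TangentSpace 𝓘(ℝ, E) x

/-- The cotangent space of `M` at `x`. -/
abbrev Cot (E : Type*) [NormedAddCommGroup E] [NormedSpace ℝ E]
    {M : Type*} [TopologicalSpace M] [ChartedSpace E M] (x : M) : Type _ :=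
  TangentSpace 𝓘(ℝ, E) x →L[ℝ] ℝ

/-- The fibre at `x` of the big tangent bundle `TM ⊕ T*M`. -/
abbrev BigTan (E : Type*) [NormedAddCommGroup E] [NormedSpace ℝ E]
    {M : Type*} [TopologicalSpace M] [ChartedSpace E M] (x : M) : Type _ :=
  Tan E x × Cot E x

/-- A vector field is smooth as a section of the tangent bundle. -/
def SmoothVF (X : Π x : M, Tan E x) : Prop :=
  ContMDiff 𝓘(ℝ, E) (𝓘(ℝ, E).prod 𝓘(ℝ, E)) ∞
    (fun x ↦ TotalSpace.mk' E (E := fun x : M ↦ Tan E x) x (X x))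

/-- A one-form is smooth as a section of the cotangent bundle. -/
def SmoothForm (α : Π x : M, Cot E x) : Prop :=
  ContMDiff 𝓘(ℝ, E) (𝓘(ℝ, E).prod 𝓘(ℝ, E →L[ℝ] ℝ)) ∞
    (fun x ↦ TotalSpace.mk' (E →L[ℝ] ℝ) (E := fun x : M ↦ Tan E x →L[ℝ] ℝ) x (α x))

/-- A `(1,1)`-tensor field is smooth as a section of the bundle `End(TM)`. -/
def SmoothTensor (φ : Π x : M, Tan E x →L[ℝ] Tan E x) : Prop :=
  ContMDiff 𝓘(ℝ, E) (𝓘(ℝ, E).prod 𝓘(ℝ, E →L[ℝ] E)) ∞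
    (fun x ↦ TotalSpace.mk' (E →L[ℝ] E) (E := fun x : M ↦ Tan E x →L[ℝ] Tan E x) x (φ x))

/-- A section `x ↦ X x + α x` of `TM ⊕ T*M` is smooth. -/
def SmoothSec (s : Π x : M, BigTan E x) : Prop :=
  SmoothVF (fun x ↦ (s x).1) ∧ SmoothForm (fun x ↦ (s x).2)

/-- A fibrewise linear endomorphism of `TM ⊕ T*M` is smooth: it maps smooth sections to smooth
sections. -/
def SmoothEndo (Ψ : Π x : M, BigTan E x →ₗ[ℝ] BigTan E x) : Prop :=
  ∀ s : Π x : M, BigTan E x, SmoothSec s → SmoothSec (fun x ↦ Ψ x (s x))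

/-! ### Cartan calculus -/

/-- The exterior derivative of a one-form, as the bilinear form `(v, w) ↦ dα(v, w)`, with the
convention `dα(X, Y) = X(α(Y)) - Y(α(X)) - α([X, Y])`. At `x`, the form is written in the
preferred chart at `x` as an `E →L[ℝ] ℝ`-valued function `A` on the model space `E`, and
`(v, w) ↦ (D_v A) w - (D_w A) v` is pulled back to the tangent space at `x`. -/
def extD (α : Π x : M, Cot E x) (x : M) : Tan E x →L[ℝ] Tan E x →L[ℝ] ℝ :=
  let A : E → (E →L[ℝ] ℝ) := fun y ↦
    (α ((extChartAt 𝓘(ℝ, E) x).symm y)).comp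
      (mfderiv 𝓘(ℝ, E) 𝓘(ℝ, E) (extChartAt 𝓘(ℝ, E) x).symm y)
  let D : E →L[ℝ] E →L[ℝ] ℝ := fderiv ℝ A (extChartAt 𝓘(ℝ, E) x x)
  let T : Tan E x →L[ℝ] E := mfderiv 𝓘(ℝ, E) 𝓘(ℝ, E) (extChartAt 𝓘(ℝ, E) x) x
  (ContinuousLinearMap.precomp ℝ T).comp ((D - D.flip).comp T)

/-- The differential of a real function, as a one-form. -/
def dFun (f : M → ℝ) (x : M) : Cot E x :=
  mfderiv 𝓘(ℝ, E) 𝓘(ℝ, ℝ) f x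

/-- The Lie derivative of a one-form, `L_X α = ι_X dα + d(ι_X α)`. -/
def lieD (X : Π x : M, Tan E x) (α : Π x : M, Cot E x) (x : M) : Cot E x :=
  extD α x (X x) + dFun (fun y ↦ α y (X y)) x

/-- The Courant bracket
`[[X + α, Y + β]] = [X, Y] + L_X β - L_Y α - (1/2) d(ι_X β - ι_Y α)`. -/
def courant (s t : Π x : M, BigTan E x) (x : M) : BigTan E x :=
  (VectorField.mlieBracket 𝓘(ℝ, E) (fun y ↦ (s y).1) (fun y ↦ (t y).1) x,
    lieD (fun y ↦ (s y).1) (fun y ↦ (t y).2) x - lieD (fun y ↦ (t y).1) (fun y ↦ (s y).2) x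
      - (1 / 2 : ℝ) • dFun (fun y ↦ (t y).2 (s y).1 - (s y).2 (t y).1) x)

/-- The neutral metric `⟨X + α, Y + β⟩ = (1/2)(β(X) + α(Y))`. -/
def pairing {x : M} (u v : BigTan E x) : ℝ :=
  (1 / 2) * (v.2 u.1 + u.2 v.1)

/-! ### Complexified big tangent bundle

An element `u + i v` of `(TM ⊕ T*M) ⊗ ℂ` is written as the pair `(u, v)` of its real and imaginary
parts. -/

/-- The complex bilinear extension of the Courant bracket to sections `s.1 + i s.2` of
`(TM ⊕ T*M) ⊗ ℂ`. -/
def courantC (s t : Π x : M, BigTan E x × BigTan E x) (x : M) : BigTan E x × BigTan E x :=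
  (courant (fun y ↦ (s y).1) (fun y ↦ (t y).1) x - courant (fun y ↦ (s y).2) (fun y ↦ (t y).2) x,
    courant (fun y ↦ (s y).1) (fun y ↦ (t y).2) x + courant (fun y ↦ (s y).2) (fun y ↦ (t y).1) x)

/-- A family of subsets of the fibres of `(TM ⊕ T*M) ⊗ ℂ` is closed under the Courant bracket:
the bracket of two smooth sections with values in it has values in it. -/
def Involutive (L : Π x : M, Set (BigTan E x × BigTan E x)) : Prop :=
  ∀ s t : Π x : M, BigTan E x × BigTan E x,
    SmoothSec (fun x ↦ (s x).1) → SmoothSec (fun x ↦ (s x).2) →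
    SmoothSec (fun x ↦ (t x).1) → SmoothSec (fun x ↦ (t x).2) →
    (∀ x, s x ∈ L x) → (∀ x, t x ∈ L x) → ∀ x, courantC s t x ∈ L x

/-- The fibre of the `√-1`-eigenbundle `E^(1,0)` of `Φ`: `Φ(u + i v) = i (u + i v)` means
`Φ u = -v` and `Φ v = u`. -/
def eigenI {x : M} (Φ : BigTan E x →ₗ[ℝ] BigTan E x) : Set (BigTan E x × BigTan E x) :=
  {w | Φ w.1 = -w.2 ∧ Φ w.2 = w.1}

/-- The fibre of `(complex line spanned by e) ⊕ E^(1,0)`; the line consists of the elements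
`(a + i b) e`. With `e = E₊` it is `L⁺`, with `e = E₋` it is `L⁻`. -/
def bundleL {x : M} (Φ : BigTan E x →ₗ[ℝ] BigTan E x) (e : BigTan E x) :
    Set (BigTan E x × BigTan E x) :=
  {w | ∃ a b : ℝ, ∃ w' ∈ eigenI Φ, w = (a • e, b • e) + w'}

/-! ### Generalized contact structures -/

/-- `(Φ, E₊, E₋)` is a generalized almost contact structure. Here `A ⊗ B` stands for the
endomorphism `v ↦ 2⟨A, v⟩ B`. -/
structure IsGenAlmostContact (Φ : Π x : M, BigTan E x →ₗ[ℝ] BigTan E x)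
    (Ep Em : Π x : M, BigTan E x) : Prop where
  smooth_Φ : SmoothEndo Φ
  smooth_Ep : SmoothSec Ep
  smooth_Em : SmoothSec Em
  skew : ∀ x (u v : BigTan E x), pairing (Φ x u) v + pairing u (Φ x v) = 0
  sq : ∀ x (u : BigTan E x), Φ x (Φ x u) =
    -u + (2 * pairing (Ep x) u) • Em x + (2 * pairing (Em x) u) • Ep x
  isotropic_Ep : ∀ x, pairing (Ep x) (Ep x) = 0
  isotropic_Em : ∀ x, pairing (Em x) (Em x) = 0
  dual : ∀ x, 2 * pairing (Ep x) (Em x) = 1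

/-- `(Φ, E₊, E₋)` is strong: both `L⁺` and `L⁻` are closed under the Courant bracket. -/
def IsStrong (Φ : Π x : M, BigTan E x →ₗ[ℝ] BigTan E x) (Ep Em : Π x : M, BigTan E x) : Prop :=
  Involutive (fun x ↦ bundleL (Φ x) (Ep x)) ∧ Involutive (fun x ↦ bundleL (Φ x) (Em x))

/-- `(Φ, E₊, E₋)` is a normal generalized contact structure: it is strong and
`[[E₊, E₋]] = 0`. -/
structure IsNormalGenContact (Φ : Π x : M, BigTan E x →ₗ[ℝ] BigTan E x)
    (Ep Em : Π x : M, BigTan E x) : Prop where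
  almost_contact : IsGenAlmostContact Φ Ep Em
  strong : IsStrong Φ Ep Em
  bracket_zero : ∀ x, courant Ep Em x = 0

/-- `G` is a generalized Riemannian metric: a smooth endomorphism of `TM ⊕ T*M` with `G* = G`,
`G² = 1`, and `⟨G u, u⟩ > 0` for `u ≠ 0`. -/
structure IsGenMetric (G : Π x : M, BigTan E x →ₗ[ℝ] BigTan E x) : Prop where
  smooth_G : SmoothEndo G
  selfAdjoint : ∀ x (u v : BigTan E x), pairing (G x u) v = pairing u (G x v)
  sq : ∀ x (u : BigTan E x), G x (G x u) = u
  pos : ∀ x (u : BigTan E x), u ≠ 0 → 0 < pairing (G x u) u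

/-- `(Φ, E₊, E₋, G)` is a normal generalized contact metric structure; the compatibility condition
is `-Φ G Φ = G - E₊ ⊗ E₊ - E₋ ⊗ E₋`. -/
structure IsNormalGenContactMetric (Φ : Π x : M, BigTan E x →ₗ[ℝ] BigTan E x)
    (Ep Em : Π x : M, BigTan E x) (G : Π x : M, BigTan E x →ₗ[ℝ] BigTan E x) : Prop where
  normal : IsNormalGenContact Φ Ep Em
  metric : IsGenMetric G
  compat : ∀ x (u : BigTan E x), -Φ x (G x (Φ x u)) =
    G x u - (2 * pairing (Ep x) u) • Ep x - (2 * pairing (Em x) u) • Em x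

/-! ### The canonical Poisson structure and generalized Sasakian structures -/

/-- The map `T*M → TM`, `α ↦ π(α, ·)`, of the canonical bivector `π₀` underlying `Φ`. The bivector
underlying a generalized complex structure `J` is the block `pr_TM ∘ J|_{T*M}` of `J`; since `Φ`
vanishes on `E₊` and `E₋`, the block of `Φ` is the extension by zero of the bivector
underlying the restriction of `Φ` to the orthogonal complement of `E₊` and `E₋`. -/
def poissonZero {x : M} (Φ : BigTan E x →ₗ[ℝ] BigTan E x) : Cot E x →ₗ[ℝ] Tan E x :=
  (LinearMap.fst ℝ (Tan E x) (Cot E x)).comp (Φ.comp (LinearMap.inr ℝ (Tan E x) (Cot E x)))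

/-- Evaluation of covectors at `v`. -/
def evalAt {x : M} (v : Tan E x) : Cot E x →ₗ[ℝ] ℝ where
  toFun α := α v
  map_add' _ _ := rfl
  map_smul' _ _ := rfl

/-- The map `α ↦ (v ∧ w)(α, ·) = α(v) w - α(w) v` of the bivector `v ∧ w`. -/
def wedge {x : M} (v w : Tan E x) : Cot E x →ₗ[ℝ] Tan E x :=
  (evalAt v).smulRight w - (evalAt w).smulRight v

/-- The canonical Poisson structure `π_M = π₀ + e₊ ∧ e₋`, where `e₊`, `e₋` are the vector parts of
`E₊`, `E₋`. -/
def poissonM (Φ : Π x : M, BigTan E x →ₗ[ℝ] BigTan E x) (Ep Em : Π x : M, BigTan E x) (x : M) :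
    Cot E x →ₗ[ℝ] Tan E x :=
  poissonZero (Φ x) + wedge (Ep x).1 (Em x).1

/-- `η = pr_{T*M} E₊ + pr_{T*M} E₋`. -/
def etaOf (Ep Em : Π x : M, BigTan E x) (x : M) : Cot E x :=
  (Ep x).2 + (Em x).2

/-- The endomorphism `I + e^t dη π_M` of `T*_x M`, where `dη` is the map `v ↦ ι_v dη`. -/
def gaugeMap (Φ : Π x : M, BigTan E x →ₗ[ℝ] BigTan E x) (Ep Em : Π x : M, BigTan E x)
    (t : ℝ) (x : M) : Module.End ℝ (Cot E x) :=
  1 + Real.exp t • (extD (etaOf Ep Em) x).toLinearMap.comp (poissonM Φ Ep Em x)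

/-- `(M, Φ, E₊, E₋, G)` is generalized Sasakian. -/
structure IsGenSasakian (Φ : Π x : M, BigTan E x →ₗ[ℝ] BigTan E x)
    (Ep Em : Π x : M, BigTan E x) (G : Π x : M, BigTan E x →ₗ[ℝ] BigTan E x) : Prop where
  normalContactMetric : IsNormalGenContactMetric Φ Ep Em G
  d_eta_ne_zero : extD (etaOf Ep Em) ≠ 0
  invertible : ∀ (t : ℝ) (x : M), IsUnit (gaugeMap Φ Ep Em t x)

/-! ### Classical Sasakian structures -/

/-- A smooth Riemannian metric on `M`. -/
abbrev Metric (E : Type*) [NormedAddCommGroup E] [NormedSpace ℝ E]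
    (M : Type*) [TopologicalSpace M] [ChartedSpace E M] [IsManifold 𝓘(ℝ, E) ∞ M] : Type _ :=
  ContMDiffRiemannianMetric 𝓘(ℝ, E) ∞ E (fun x : M ↦ Tan E x)

/-- The value at `x` of the torsion `[φ, φ](X, Y) = φ²[X, Y] + [φX, φY] - φ[φX, Y] - φ[X, φY]`. -/
def nijenhuis (φ : Π x : M, Tan E x →L[ℝ] Tan E x) (X Y : Π x : M, Tan E x) (x : M) : Tan E x :=
  φ x (φ x (VectorField.mlieBracket 𝓘(ℝ, E) X Y x))
    + VectorField.mlieBracket 𝓘(ℝ, E) (fun y ↦ φ y (X y)) (fun y ↦ φ y (Y y)) x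
    - φ x (VectorField.mlieBracket 𝓘(ℝ, E) (fun y ↦ φ y (X y)) Y x)
    - φ x (VectorField.mlieBracket 𝓘(ℝ, E) X (fun y ↦ φ y (Y y)) x)

/-- `(φ, ξ, η, g)` is a (classical) Sasakian structure: a normal contact metric structure. The
exterior derivative is `dη(X, Y) = X(η(Y)) - Y(η(X)) - η([X, Y])`, without a factor `1/2`; for
authors who put the factor `1/2` into `dη`, the last two conditions read `dη(X, Y) = g(X, φY)` and
`[φ, φ] + 2 dη ⊗ ξ = 0`. -/
structure IsSasakian (φ : Π x : M, Tan E x →L[ℝ] Tan E x)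
    (ξ : Π x : M, Tan E x) (η : Π x : M, Cot E x) (g : Metric E M) : Prop where
  smooth_φ : SmoothTensor φ
  smooth_ξ : SmoothVF ξ
  smooth_η : SmoothForm η
  eta_xi : ∀ x, η x (ξ x) = 1
  phi_sq : ∀ x (v : Tan E x), φ x (φ x v) = -v + η x v • ξ x
  metric_compat : ∀ x (v w : Tan E x), g.inner x (φ x v) (φ x w) = g.inner x v w - η x v * η x w
  contact_metric : ∀ x (v w : Tan E x), extD η x v w = 2 * g.inner x v (φ x w)
  normal : ∀ X Y : Π x : M, Tan E x, SmoothVF X → SmoothVF Y →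
    ∀ x, nijenhuis φ X Y x + extD η x (X x) (Y x) • ξ x = 0

/-! ### The generalized structure of a classical structure -/

/-- `Φ = diag(φ, -φ*)`, where `φ*α = α ∘ φ`. -/
def diagEndo (φ : Π x : M, Tan E x →L[ℝ] Tan E x) (x : M) : BigTan E x →ₗ[ℝ] BigTan E x where
  toFun u := (φ x u.1, -(u.2.comp (φ x)))
  map_add' u v := by
    ext w
    · simp
    · simp [add_comm]
  map_smul' c u := by
    ext w
    · simp
    · simp

/-- A vector field as a section of `TM ⊕ T*M`. -/
def ofVF (X : Π x : M, Tan E x) (x : M) : BigTan E x := (X x, 0)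

/-- A one-form as a section of `TM ⊕ T*M`. -/
def ofForm (α : Π x : M, Cot E x) (x : M) : BigTan E x := (0, α x)

section

variable [FiniteDimensional ℝ E]

/-- The map `T_x M → T*_x M`, `v ↦ g(v, ·)`, of a Riemannian metric is bijective. -/
theorem inner_bijective (g : Metric E M) (x : M) :
    Function.Bijective (g.inner x : Tan E x → Cot E x) := by
  have : FiniteDimensional ℝ (Tan E x) := inferInstanceAs (FiniteDimensional ℝ E)
  have : T2Space (Tan E x) := inferInstanceAs (T2Space E)
  have hinj : Function.Injective (g.inner x : Tan E x → Cot E x) := by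
    refine (injective_iff_map_eq_zero (g.inner x)).2 fun v hv ↦ ?_
    by_contra hne
    have h := g.pos x v hne
    rw [hv] at h
    simp at h
  let e : (Tan E x →ₗ[ℝ] ℝ) ≃ₗ[ℝ] Cot E x := LinearMap.toContinuousLinearMap
  have : FiniteDimensional ℝ (Cot E x) := e.finiteDimensional
  have hd : Module.finrank ℝ (Tan E x) = Module.finrank ℝ (Cot E x) :=
    (Subspace.dual_finrank_eq (K := ℝ) (V := Tan E x)).symm.trans e.finrank_eq
  exact ⟨hinj, (LinearMap.injective_iff_surjective_of_finrank_eq_finrank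
    (f := (g.inner x).toLinearMap) hd).1 hinj⟩

/-- The isomorphism `g : T_x M → T*_x M`, `v ↦ g(v, ·)`, of a Riemannian metric. -/
def flat (g : Metric E M) (x : M) : Tan E x ≃ₗ[ℝ] Cot E x :=
  LinearEquiv.ofBijective (g.inner x).toLinearMap (inner_bijective g x)

/-- `G = (0, g⁻¹; g, 0)`, that is, `G(X + α) = g⁻¹ α + g X`. -/
def metricEndo (g : Metric E M) (x : M) : BigTan E x →ₗ[ℝ] BigTan E x :=
  ((flat g x).symm.toLinearMap.comp (LinearMap.snd ℝ (Tan E x) (Cot E x))).prod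
    ((flat g x).toLinearMap.comp (LinearMap.fst ℝ (Tan E x) (Cot E x)))

end

end GenGeom

end

noncomputable section

namespace GenGeom

variable {E : Type*} [NormedAddCommGroup E] [NormedSpace ℝ E]
  {M : Type*} [TopologicalSpace M] [ChartedSpace E M] [IsManifold 𝓘(ℝ, E) ∞ M]

/-! Since `Φ` is block diagonal, each bundle `L` has the form `D ⊕ Ann D` for a complex distribution
`D`: the span of `ξ` and the `√-1`-eigenspace of `φ` for `E₊`, the eigenspace alone for `E₋`
(`bundleL_ofVF`, `bundleL_ofForm`). By Cartan's formula such a sum is Courant-involutive once `D` is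
closed under the Lie bracket and has a smooth section through each of its vectors
(`involutive_diracSet`).

Closedness of the larger distribution is normality composed with `φ`, which kills the `ξ`-valued
term (`bracketClosed_reebEigen`). The eigenspace is the part of it in `ker η`, and `η` of a bracket
in `ker η` is `-dη`, which vanishes on two `√-1`-eigenvectors because `φ` is skew for `g`
(`bracketClosed_eigen`).

The remaining conditions are short. The metric identities are pointwise algebra apart from the
smoothness of `g⁻¹`. If `dη` were zero then `φ = 0` and every tangent space would be spanned by `ξ`.
The canonical Poisson structure is identically zero, so the gauge map is the identity. -/

/-! ### Smooth sections of the tangent, cotangent and endomorphism bundles -/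

theorem isManifold_two (E : Type*) [NormedAddCommGroup E] [NormedSpace ℝ E]
    (M : Type*) [TopologicalSpace M] [ChartedSpace E M] [IsManifold 𝓘(ℝ, E) ∞ M] :
    IsManifold 𝓘(ℝ, E) 2 M := IsManifold.of_le (n := ∞) ENat.LEInfty.out

theorem SmoothVF.mdifferentiableAt {X : Π x : M, Tan E x} (hX : SmoothVF X) (x : M) :
    MDifferentiableAt 𝓘(ℝ, E) (𝓘(ℝ, E).prod 𝓘(ℝ, E))
      (fun x ↦ TotalSpace.mk' E (E := fun x : M ↦ Tan E x) x (X x)) x :=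
  (hX x).mdifferentiableAt (by simp)

theorem SmoothVF.add {X Y : Π x : M, Tan E x} (hX : SmoothVF X) (hY : SmoothVF Y) :
    SmoothVF (X + Y) := ContMDiff.add_section hX hY

theorem SmoothVF.neg {X : Π x : M, Tan E x} (hX : SmoothVF X) : SmoothVF (-X) :=
  ContMDiff.neg_section hX

theorem SmoothVF.smul {f : M → ℝ} {X : Π x : M, Tan E x} (hf : ContMDiff 𝓘(ℝ, E) 𝓘(ℝ, ℝ) ∞ f)
    (hX : SmoothVF X) : SmoothVF (f • X) := ContMDiff.smul_section hf hX

theorem SmoothVF.const_smul {X : Π x : M, Tan E x} (c : ℝ) (hX : SmoothVF X) :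
    SmoothVF (c • X) := ContMDiff.const_smul_section hX

theorem SmoothForm.neg {α : Π x : M, Cot E x} (hα : SmoothForm α) : SmoothForm (-α) :=
  ContMDiff.neg_section hα

theorem SmoothTensor.apply {φ : Π x : M, Tan E x →L[ℝ] Tan E x} {X : Π x : M, Tan E x}
    (hφ : SmoothTensor φ) (hX : SmoothVF X) : SmoothVF (fun x ↦ φ x (X x)) :=
  ContMDiff.clm_bundle_apply hφ hX

theorem SmoothForm.apply {α : Π x : M, Cot E x} {X : Π x : M, Tan E x}
    (hα : SmoothForm α) (hX : SmoothVF X) :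
    ContMDiff 𝓘(ℝ, E) 𝓘(ℝ, ℝ) ∞ (fun x ↦ α x (X x)) := fun x ↦ by
  have h := ContMDiff.clm_bundle_apply (E₂ := fun _ : M ↦ ℝ) hα hX x
  rw [contMDiffAt_totalSpace] at h
  exact h.2

theorem smoothVF_zero : SmoothVF (0 : Π x : M, Tan E x) := contMDiff_zeroSection ℝ _

theorem smoothForm_zero : SmoothForm (0 : Π x : M, Cot E x) := contMDiff_zeroSection ℝ _

/-- Near `x` the trivialization of `TM` and its inverse cancel in the middle, so the local
representative of the composite is the composite of the representatives. -/
theorem SmoothForm.comp {α : Π x : M, Cot E x} {φ : Π x : M, Tan E x →L[ℝ] Tan E x}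
    (hα : SmoothForm α) (hφ : SmoothTensor φ) : SmoothForm (fun x ↦ (α x).comp (φ x)) := by
  intro x
  have h1 := hα x
  have h2 := hφ x
  rw [contMDiffAt_hom_bundle] at h1 h2 ⊢
  refine ⟨h1.1, (ContMDiffAt.clm_comp h1.2 h2.2).congr_of_eventuallyEq ?_⟩
  filter_upwards [(trivializationAt E (fun x : M ↦ Tan E x) x).open_baseSet.mem_nhds
    (mem_baseSet_trivializationAt E (fun x : M ↦ Tan E x) x)] with y hy
  ext v
  simp only [ContinuousLinearMap.inCoordinates, ContinuousLinearMap.coe_comp,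
    Function.comp_apply]
  rw [Trivialization.symmL_continuousLinearMapAt _ hy]

/-- Every tangent vector is the value of a smooth vector field. -/
theorem exists_smoothVF_eq [FiniteDimensional ℝ E] [T2Space M] (x : M) (v : Tan E x) :
    ∃ X : Π x : M, Tan E x, SmoothVF X ∧ X x = v := by
  obtain ⟨s, hs, h⟩ := FiberBundle.exists_contMDiffOn_extend (k := ∞) 𝓘(ℝ, E) E
    (V := fun x : M ↦ Tan E x) v
  obtain ⟨f, -, hf⟩ := (SmoothBumpFunction.nhds_basis_tsupport (I := 𝓘(ℝ, E)) x).mem_iff.1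
    (interior_mem_nhds.2 hs)
  -- The local extension is cut off by a bump function equal to `1` at `x` and supported where the
  -- extension is smooth.
  refine ⟨(f : M → ℝ) • FiberBundle.extend E v, ContMDiffOn.smul_section_of_tsupport
    f.contMDiff.contMDiffOn isOpen_interior hf (h.mono interior_subset), ?_⟩
  simp

/-! ### Cartan calculus in the preferred chart -/

omit [IsManifold 𝓘(ℝ, E) ∞ M] in
/-- The differential of a real function computed in the preferred chart. -/
theorem dFun_eq_fderiv {f : M → ℝ} {x : M} (hf : MDifferentiableAt 𝓘(ℝ, E) 𝓘(ℝ, ℝ) f x) :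
    dFun (E := E) f x =
      fderiv ℝ (fun y ↦ f ((extChartAt 𝓘(ℝ, E) x).symm y)) (extChartAt 𝓘(ℝ, E) x x) := by
  simp only [dFun, mfderiv, hf, ModelWithCorners.range_eq_univ, fderivWithin_univ]
  rfl

/-- The representative of a one-form in the preferred chart at `x`. -/
def chartForm (α : Π x : M, Cot E x) (x : M) (y : E) : E →L[ℝ] ℝ :=
  (α ((extChartAt 𝓘(ℝ, E) x).symm y)).comp
    (mfderiv 𝓘(ℝ, E) 𝓘(ℝ, E) (extChartAt 𝓘(ℝ, E) x).symm y)

/-- The representative of a vector field in the preferred chart at `x`. -/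
def chartField (X : Π x : M, Tan E x) (x : M) (y : E) : E :=
  VectorField.mpullbackWithin 𝓘(ℝ, E) 𝓘(ℝ, E) (extChartAt 𝓘(ℝ, E) x).symm X univ y

theorem extD_apply (α : Π x : M, Cot E x) (x : M) (v w : Tan E x) :
    extD α x v w = fderiv ℝ (chartForm α x) (extChartAt 𝓘(ℝ, E) x x) v w
      - fderiv ℝ (chartForm α x) (extChartAt 𝓘(ℝ, E) x x) w v := by
  have h := mfderiv_extChartAt_self (I := 𝓘(ℝ, E)) (x := x)
  simp only [extD]
  rw [h]
  rfl

/-- The derivative of the inverse chart is the inverse of the tangent trivialization, so near the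
point `chartForm` is the bundle coordinate of `α` read in the chart. -/
theorem SmoothForm.differentiableAt_chartForm {α : Π x : M, Cot E x} (hα : SmoothForm α) (x : M) :
    DifferentiableAt ℝ (chartForm α x) (extChartAt 𝓘(ℝ, E) x x) := by
  have h := ((contMDiffAt_hom_bundle _).1 (hα x)).2.mdifferentiableAt (by simp)
  have hs := mdifferentiableWithinAt_extChartAt_symm (I := 𝓘(ℝ, E))
    (mem_extChartAt_target (I := 𝓘(ℝ, E)) x)
  rw [ModelWithCorners.range_eq_univ, mdifferentiableWithinAt_univ] at hs
  have hx := extChartAt_to_inv (I := 𝓘(ℝ, E)) x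
  have hc := (MDifferentiableAt.comp_of_eq (extChartAt 𝓘(ℝ, E) x x) h hs hx).differentiableAt
  refine hc.congr_of_eventuallyEq ?_
  filter_upwards [extChartAt_target_mem_nhds (I := 𝓘(ℝ, E)) x] with y hy
  have hmem : (extChartAt 𝓘(ℝ, E) x).symm y ∈ (chartAt E x).source := by
    rw [← extChartAt_source 𝓘(ℝ, E)]
    exact (extChartAt 𝓘(ℝ, E) x).map_target hy
  have hs := TangentBundle.symmL_trivializationAt (I := 𝓘(ℝ, E)) hmem
  rw [ModelWithCorners.range_eq_univ, mfderivWithin_univ,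
    (extChartAt 𝓘(ℝ, E) x).right_inv hy] at hs
  simp only [chartForm, Function.comp_apply, ContinuousLinearMap.inCoordinates]
  rw [← hs]
  have ht := Bundle.Trivial.continuousLinearMapAt_trivialization ℝ M ℝ
    ((extChartAt 𝓘(ℝ, E) x).symm y)
  exact (congrArg (fun L : ℝ →L[ℝ] ℝ ↦ L.comp ((α ((extChartAt 𝓘(ℝ, E) x).symm y)).comp
    ((trivializationAt E (TangentSpace 𝓘(ℝ, E)) x).symmL ℝ
      ((extChartAt 𝓘(ℝ, E) x).symm y)))) ht).symm

theorem SmoothVF.differentiableAt_chartField [CompleteSpace E] {X : Π x : M, Tan E x}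
    (hX : SmoothVF X) (x : M) :
    DifferentiableAt ℝ (chartField X x) (extChartAt 𝓘(ℝ, E) x x) := by
  have := isManifold_two E M
  have h := (hX.mdifferentiableAt x).mdifferentiableWithinAt
    (s := univ) |>.differentiableWithinAt_mpullbackWithin_vectorField
  rw [ModelWithCorners.range_eq_univ, preimage_univ, univ_inter] at h
  exact differentiableWithinAt_univ.1 h

theorem chartForm_chartField (α : Π x : M, Cot E x) (X : Π x : M, Tan E x) (x : M) {y : E}
    (hy : y ∈ (extChartAt 𝓘(ℝ, E) x).target) :
    chartForm α x y (chartField X x y) =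
      α ((extChartAt 𝓘(ℝ, E) x).symm y) (X ((extChartAt 𝓘(ℝ, E) x).symm y)) := by
  have h := isInvertible_mfderivWithin_extChartAt_symm (I := 𝓘(ℝ, E)) hy
  rw [ModelWithCorners.range_eq_univ, mfderivWithin_univ] at h
  simp only [chartForm, chartField, VectorField.mpullbackWithin_apply, mfderivWithin_univ]
  exact congrArg (α ((extChartAt 𝓘(ℝ, E) x).symm y))
    (h.self_apply_inverse (X ((extChartAt 𝓘(ℝ, E) x).symm y)))

theorem mfderiv_extChartAt_symm_self (x : M) :
    (mfderiv 𝓘(ℝ, E) 𝓘(ℝ, E) (extChartAt 𝓘(ℝ, E) x).symm (extChartAt 𝓘(ℝ, E) x x) : E →L[ℝ] E) =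
      ContinuousLinearMap.id ℝ E := by
  have h := mfderiv_extChartAt_comp_mfderivWithin_extChartAt_symm (I := 𝓘(ℝ, E))
    (mem_extChartAt_target (I := 𝓘(ℝ, E)) x)
  rw [ModelWithCorners.range_eq_univ, mfderivWithin_univ, extChartAt_to_inv,
    mfderiv_extChartAt_self] at h
  exact h

theorem chartForm_self (α : Π x : M, Cot E x) (x : M) :
    chartForm α x (extChartAt 𝓘(ℝ, E) x x) = α x := by
  have h : ∀ z, z = x → (α z : E →L[ℝ] ℝ) = α x := by rintro _ rfl; rfl
  unfold chartForm
  exact congrArg₂ (fun (a : E →L[ℝ] ℝ) (b : E →L[ℝ] E) ↦ a.comp b)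
    (h _ (extChartAt_to_inv (I := 𝓘(ℝ, E)) x)) (mfderiv_extChartAt_symm_self x)

theorem chartField_self (X : Π x : M, Tan E x) (x : M) :
    chartField X x (extChartAt 𝓘(ℝ, E) x x) = X x := by
  have h : ∀ z, z = x → (X z : E) = X x := by rintro _ rfl; rfl
  have h' : ∀ F : E →L[ℝ] E, F = ContinuousLinearMap.id ℝ E →
      F.inverse = ContinuousLinearMap.id ℝ E := by
    rintro _ rfl
    exact ContinuousLinearMap.inverse_id
  simp only [chartField, VectorField.mpullbackWithin_apply, mfderivWithin_univ]
  exact congrArg₂ (fun (L : E →L[ℝ] E) (v : E) ↦ L v) (h' _ (mfderiv_extChartAt_symm_self x))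
    (h _ (extChartAt_to_inv (I := 𝓘(ℝ, E)) x))

theorem mlieBracket_eq_chartField (X Y : Π x : M, Tan E x) (x : M) :
    VectorField.mlieBracket 𝓘(ℝ, E) X Y x =
      fderiv ℝ (chartField Y x) (extChartAt 𝓘(ℝ, E) x x) (X x)
        - fderiv ℝ (chartField X x) (extChartAt 𝓘(ℝ, E) x x) (Y x) := by
  rw [← VectorField.mlieBracketWithin_univ, VectorField.mlieBracketWithin_apply,
    mfderiv_extChartAt_self, ModelWithCorners.range_eq_univ, preimage_univ, univ_inter]
  have h : VectorField.lieBracketWithin ℝ (chartField X x) (chartField Y x) univ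
      (extChartAt 𝓘(ℝ, E) x x) =
        fderiv ℝ (chartField Y x) (extChartAt 𝓘(ℝ, E) x x) (X x)
        - fderiv ℝ (chartField X x) (extChartAt 𝓘(ℝ, E) x x) (Y x) := by
    rw [VectorField.lieBracketWithin_univ, VectorField.lieBracket_eq]
    beta_reduce
    rw [chartField_self, chartField_self]
  exact congrArg₂ (fun (L : E →L[ℝ] E) (v : E) ↦ L v) ContinuousLinearMap.inverse_id h

/-- Links the chart definition of `extD` to the invariant formula. Antisymmetrizing the product rule
for `α(Y)` and `α(X)` leaves `α` applied to the coordinate expression of the bracket. -/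
theorem extD_eq [CompleteSpace E] {α : Π x : M, Cot E x} {X Y : Π x : M, Tan E x}
    (hα : SmoothForm α) (hX : SmoothVF X) (hY : SmoothVF Y) (x : M) :
    extD α x (X x) (Y x) = dFun (fun y ↦ α y (Y y)) x (X x) - dFun (fun y ↦ α y (X y)) x (Y x)
      - α x (VectorField.mlieBracket 𝓘(ℝ, E) X Y x) := by
  have key : ∀ {Z : Π x : M, Tan E x}, SmoothVF Z → ∀ v : Tan E x,
      dFun (fun y ↦ α y (Z y)) x v =
        fderiv ℝ (chartForm α x) (extChartAt 𝓘(ℝ, E) x x) v (Z x) +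
          α x (fderiv ℝ (chartField Z x) (extChartAt 𝓘(ℝ, E) x x) v) := by
    intro Z hZ v
    rw [dFun_eq_fderiv ((hα.apply hZ x).mdifferentiableAt (by simp))]
    have hev : (fun y ↦ α ((extChartAt 𝓘(ℝ, E) x).symm y) (Z ((extChartAt 𝓘(ℝ, E) x).symm y)))
        =ᶠ[nhds (extChartAt 𝓘(ℝ, E) x x)] fun y ↦ chartForm α x y (chartField Z x y) := by
      filter_upwards [extChartAt_target_mem_nhds (I := 𝓘(ℝ, E)) x] with y hy
      exact (chartForm_chartField α Z x hy).symm
    rw [hev.fderiv_eq, fderiv_clm_apply (hα.differentiableAt_chartForm x)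
      (hZ.differentiableAt_chartField x), chartForm_self, chartField_self]
    exact add_comm _ _
  have hsub : ∀ v w : E, α x (v - w : E) = α x v - α x w := fun v w ↦ map_sub (α x) v w
  rw [key hX, key hY, extD_apply, mlieBracket_eq_chartField, hsub]
  abel

section

omit [IsManifold 𝓘(ℝ, E) ∞ M]

theorem dFun_sub {f h : M → ℝ} (hf : ContMDiff 𝓘(ℝ, E) 𝓘(ℝ, ℝ) ∞ f)
    (hh : ContMDiff 𝓘(ℝ, E) 𝓘(ℝ, ℝ) ∞ h) (x : M) :
    dFun (E := E) (fun y ↦ f y - h y) x = dFun f x - dFun h x :=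
  mfderiv_sub ((hf x).mdifferentiableAt (by simp)) ((hh x).mdifferentiableAt (by simp))

theorem dFun_const (c : ℝ) (x : M) : dFun (E := E) (fun _ ↦ c) x = 0 := mfderiv_const

theorem dFun_neg (f : M → ℝ) (x : M) : dFun (E := E) (fun y ↦ -f y) x = -dFun f x := mfderiv_neg

theorem extD_swap (α : Π x : M, Cot E x) (x : M) (v w : Tan E x) :
    extD α x v w = -extD α x w v := by
  simp only [extD]
  exact (neg_sub _ _).symm

end

/-- Each Lie derivative contributes a full differential and the last term of the Courant bracket
takes half of it back. The halves that remain cancel later on isotropic sections. -/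
theorem courant_snd {s t : Π x : M, BigTan E x} (hs : SmoothSec s) (ht : SmoothSec t) (x : M) :
    (courant s t x).2 = extD (fun y ↦ (t y).2) x (s x).1 - extD (fun y ↦ (s y).2) x (t x).1
      + (1 / 2 : ℝ) • dFun (fun y ↦ (t y).2 (s y).1) x
      - (1 / 2 : ℝ) • dFun (fun y ↦ (s y).2 (t y).1) x := by
  simp only [courant, lieD]
  rw [dFun_sub (ht.2.apply hs.1) (hs.2.apply ht.1)]
  module

/-! ### Dirac structures of complex distributions -/

/-- Real and imaginary part of the Lie bracket of two complex vector fields. -/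
def complexBracket (X₁ X₂ Y₁ Y₂ : Π x : M, Tan E x) (x : M) : Tan E x × Tan E x :=
  (VectorField.mlieBracket 𝓘(ℝ, E) X₁ Y₁ x - VectorField.mlieBracket 𝓘(ℝ, E) X₂ Y₂ x,
    VectorField.mlieBracket 𝓘(ℝ, E) X₁ Y₂ x + VectorField.mlieBracket 𝓘(ℝ, E) X₂ Y₁ x)

/-- The complex form `α₁ + i α₂` vanishes on the complex vector `A + i B`. -/
def Annihilates {x : M} (α₁ α₂ : Cot E x) (z : Tan E x × Tan E x) : Prop :=
  α₁ z.1 = α₂ z.2 ∧ α₁ z.2 = -α₂ z.1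

/-- The sum of a complex distribution and its annihilator. -/
def diracSet {x : M} (D : Set (Tan E x × Tan E x)) : Set (BigTan E x × BigTan E x) :=
  {w | (w.1.1, w.2.1) ∈ D ∧ ∀ z ∈ D, Annihilates w.1.2 w.2.2 z}

/-- A family of complex tangent vectors is closed under the Lie bracket. -/
def BracketClosed (D : Π x : M, Set (Tan E x × Tan E x)) : Prop :=
  ∀ X₁ X₂ Y₁ Y₂ : Π x : M, Tan E x, SmoothVF X₁ → SmoothVF X₂ → SmoothVF Y₁ → SmoothVF Y₂ →
    (∀ x, (X₁ x, X₂ x) ∈ D x) → (∀ x, (Y₁ x, Y₂ x) ∈ D x) → ∀ x, complexBracket X₁ X₂ Y₁ Y₂ x ∈ D x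

/-- Every element of a family of complex tangent vectors extends to a smooth section. -/
def HasSections (D : Π x : M, Set (Tan E x × Tan E x)) : Prop :=
  ∀ x, ∀ z ∈ D x, ∃ Z₁ Z₂ : Π x : M, Tan E x, SmoothVF Z₁ ∧ SmoothVF Z₂ ∧
    (∀ y, (Z₁ y, Z₂ y) ∈ D y) ∧ (Z₁ x, Z₂ x) = z

/-- The contraction of `d(β₁ + i β₂)` with a section annihilated by `β₁ + i β₂` annihilates every
other such section, provided that it annihilates their bracket. -/
theorem annihilates_extD [CompleteSpace E] {β₁ β₂ : Π x : M, Cot E x}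
    {X₁ X₂ Z₁ Z₂ : Π x : M, Tan E x} (hβ₁ : SmoothForm β₁) (hβ₂ : SmoothForm β₂)
    (hX₁ : SmoothVF X₁) (hX₂ : SmoothVF X₂) (hZ₁ : SmoothVF Z₁) (hZ₂ : SmoothVF Z₂)
    (hX : ∀ x, Annihilates (β₁ x) (β₂ x) (X₁ x, X₂ x))
    (hZ : ∀ x, Annihilates (β₁ x) (β₂ x) (Z₁ x, Z₂ x)) {x : M}
    (hXZ : Annihilates (β₁ x) (β₂ x) (complexBracket X₁ X₂ Z₁ Z₂ x)) :
    Annihilates (extD β₁ x (X₁ x) - extD β₂ x (X₂ x)) (extD β₂ x (X₁ x) + extD β₁ x (X₂ x))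
      (Z₁ x, Z₂ x) := by
  -- Differentiating the annihilation identities makes every term of Cartan's formula cancel except
  -- the bracket term, which `hXZ` handles.
  have a1 : dFun (E := E) (fun y ↦ β₁ y (X₁ y)) x = dFun (fun y ↦ β₂ y (X₂ y)) x :=
    congrArg (fun f ↦ dFun f x) (funext fun y ↦ (hX y).1)
  have a2 : dFun (E := E) (fun y ↦ β₁ y (X₂ y)) x = -dFun (fun y ↦ β₂ y (X₁ y)) x :=
    (congrArg (fun f ↦ dFun f x) (funext fun y ↦ (hX y).2)).trans (dFun_neg _ x)
  have b1 : dFun (E := E) (fun y ↦ β₁ y (Z₁ y)) x = dFun (fun y ↦ β₂ y (Z₂ y)) x :=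
    congrArg (fun f ↦ dFun f x) (funext fun y ↦ (hZ y).1)
  have b2 : dFun (E := E) (fun y ↦ β₁ y (Z₂ y)) x = -dFun (fun y ↦ β₂ y (Z₁ y)) x :=
    (congrArg (fun f ↦ dFun f x) (funext fun y ↦ (hZ y).2)).trans (dFun_neg _ x)
  obtain ⟨c1, c2⟩ := hXZ
  simp only [complexBracket, map_sub, map_add] at c1 c2
  constructor <;>
  simp only [_root_.sub_apply, _root_.add_apply,
    extD_eq hβ₁ hX₁ hZ₁, extD_eq hβ₁ hX₁ hZ₂, extD_eq hβ₁ hX₂ hZ₁, extD_eq hβ₁ hX₂ hZ₂,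
    extD_eq hβ₂ hX₁ hZ₁, extD_eq hβ₂ hX₁ hZ₂, extD_eq hβ₂ hX₂ hZ₁, extD_eq hβ₂ hX₂ hZ₂,
    a1, a2, b1, b2, _root_.neg_apply] <;> linarith

/-- Isotropy removes the differentials of the pairings, so the form part of the bracket is `ι_X dβ -
ι_Y dα`. Both contractions annihilate `D` by `annihilates_extD`. -/
theorem involutive_diracSet [CompleteSpace E] {D : Π x : M, Set (Tan E x × Tan E x)}
    (hD : BracketClosed D) (hs : HasSections D) : Involutive (fun x ↦ diracSet (D x)) := by
  intro s t hs₁ hs₂ ht₁ ht₂ hsD htD x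
  refine ⟨hD _ _ _ _ hs₁.1 hs₂.1 ht₁.1 ht₂.1 (fun x ↦ (hsD x).1) (fun x ↦ (htD x).1) x,
    fun z hz ↦ ?_⟩
  -- Annihilation is tested on a single vector, but Cartan's formula needs a section of `D` through
  -- it.
  obtain ⟨Z₁, Z₂, hZ₁, hZ₂, hZ, rfl⟩ := hs x z hz
  have h1 := annihilates_extD ht₁.2 ht₂.2 hs₁.1 hs₂.1 hZ₁ hZ₂
    (fun y ↦ (htD y).2 _ (hsD y).1) (fun y ↦ (htD y).2 _ (hZ y))
    ((htD x).2 _ (hD _ _ _ _ hs₁.1 hs₂.1 hZ₁ hZ₂ (fun y ↦ (hsD y).1) hZ x))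
  have h2 := annihilates_extD hs₁.2 hs₂.2 ht₁.1 ht₂.1 hZ₁ hZ₂
    (fun y ↦ (hsD y).2 _ (htD y).1) (fun y ↦ (hsD y).2 _ (hZ y))
    ((hsD x).2 _ (hD _ _ _ _ ht₁.1 ht₂.1 hZ₁ hZ₂ (fun y ↦ (htD y).1) hZ x))
  have a1 : dFun (E := E) (fun y ↦ (t y).1.2 (s y).1.1) x =
      dFun (fun y ↦ (t y).2.2 (s y).2.1) x :=
    congrArg (fun f ↦ dFun f x) (funext fun y ↦ ((htD y).2 _ (hsD y).1).1)
  have a2 : dFun (E := E) (fun y ↦ (t y).1.2 (s y).2.1) x =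
      -dFun (fun y ↦ (t y).2.2 (s y).1.1) x :=
    (congrArg (fun f ↦ dFun f x) (funext fun y ↦ ((htD y).2 _ (hsD y).1).2)).trans (dFun_neg _ x)
  have b1 : dFun (E := E) (fun y ↦ (s y).1.2 (t y).1.1) x =
      dFun (fun y ↦ (s y).2.2 (t y).2.1) x :=
    congrArg (fun f ↦ dFun f x) (funext fun y ↦ ((hsD y).2 _ (htD y).1).1)
  have b2 : dFun (E := E) (fun y ↦ (s y).1.2 (t y).2.1) x =
      -dFun (fun y ↦ (s y).2.2 (t y).1.1) x :=
    (congrArg (fun f ↦ dFun f x) (funext fun y ↦ ((hsD y).2 _ (htD y).1).2)).trans (dFun_neg _ x)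
  obtain ⟨h11, h12⟩ := h1
  obtain ⟨h21, h22⟩ := h2
  simp only [_root_.sub_apply, _root_.add_apply] at h11 h12 h21 h22
  constructor <;>
  simp only [courantC, Prod.snd_sub, Prod.snd_add, courant_snd hs₁ ht₁, courant_snd hs₁ ht₂,
    courant_snd hs₂ ht₁, courant_snd hs₂ ht₂, a1, a2, b1, b2, _root_.sub_apply,
    _root_.add_apply, _root_.smul_apply, _root_.neg_apply,
    smul_eq_mul] <;> linarith

/-! ### Brackets of vector fields on a Sasakian manifold -/

namespace IsSasakian

variable {φ : Π x : M, Tan E x →L[ℝ] Tan E x} {ξ : Π x : M, Tan E x} {η : Π x : M, Cot E x}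
  {g : Metric E M}

/-- As `φ²ξ = 0`, the formula for `φ²` at `φξ` gives `φξ = cξ` with `c = η(φξ)`. Then `0 = φ²ξ =
c²ξ` forces `c = 0`. -/
theorem phi_xi (hS : IsSasakian φ ξ η g) (x : M) : φ x (ξ x) = 0 := by
  have h0 : φ x (φ x (ξ x)) = 0 := by simp [hS.phi_sq, hS.eta_xi]
  have h1 := hS.phi_sq x (φ x (ξ x))
  rw [h0, map_zero, eq_comm, neg_add_eq_zero] at h1
  have h2 := h0
  rw [h1, map_smul, h1, smul_smul] at h2
  have hξ : ξ x ≠ 0 := fun h ↦ by simpa [h] using hS.eta_xi x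
  have h3 : η x (φ x (ξ x)) = 0 := by simpa [hξ, hS.eta_xi] using h2
  rw [h1, h3, zero_smul]

/-- Computing `φ³v` as `φ(φ²v)` and as `φ²(φv)` gives results that differ by `η(φv)ξ`. -/
theorem eta_phi (hS : IsSasakian φ ξ η g) (x : M) (v : Tan E x) : η x (φ x v) = 0 := by
  have h1 := hS.phi_sq x (φ x v)
  rw [hS.phi_sq x v, map_add, map_neg, map_smul, hS.phi_xi, smul_zero, add_zero,
    left_eq_add] at h1
  have hξ : ξ x ≠ 0 := fun h ↦ by simpa [h] using hS.eta_xi x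
  simpa [hξ] using h1

theorem phi_cube (hS : IsSasakian φ ξ η g) (x : M) (v : Tan E x) :
    φ x (φ x (φ x v)) = -φ x v := by
  rw [hS.phi_sq, hS.eta_phi, zero_smul, add_zero]

theorem metric_xi (hS : IsSasakian φ ξ η g) (x : M) (v : Tan E x) :
    g.inner x v (ξ x) = η x v := by
  have h := hS.metric_compat x v (ξ x)
  rw [hS.phi_xi, map_zero, hS.eta_xi, mul_one] at h
  linarith

/-- This is the antisymmetry of `dη`, read through `dη = 2g(·, φ·)`. -/
theorem metric_skew (hS : IsSasakian φ ξ η g) (x : M) (v w : Tan E x) :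
    g.inner x (φ x v) w = -g.inner x v (φ x w) := by
  have h1 := hS.contact_metric x v w
  have h2 := hS.contact_metric x w v
  have h3 := extD_swap η x v w
  rw [g.symm x (φ x v) w]
  linarith

/-- The complex distribution spanned by `ξ` and the `√-1`-eigenspace of `φ`. -/
def reebEigen (φ : Π x : M, Tan E x →L[ℝ] Tan E x) (ξ : Π x : M, Tan E x) (η : Π x : M, Cot E x)
    (x : M) : Set (Tan E x × Tan E x) :=
  {z | φ x z.1 = -z.2 + η x z.2 • ξ x ∧ φ x z.2 = z.1 - η x z.1 • ξ x}

/-- The `√-1`-eigenspace of `φ`. -/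
def eigen (φ : Π x : M, Tan E x →L[ℝ] Tan E x) (x : M) : Set (Tan E x × Tan E x) :=
  {z | φ x z.1 = -z.2 ∧ φ x z.2 = z.1}

theorem hasSections_reebEigen [FiniteDimensional ℝ E] [T2Space M] (hS : IsSasakian φ ξ η g) :
    HasSections (reebEigen φ ξ η) := by
  intro x z hz
  obtain ⟨Z, hZ, hZx⟩ := exists_smoothVF_eq x z.1
  -- The real part may be any field `Z`; the imaginary part is then `-φZ` up to a multiple of `ξ`,
  -- and a constant multiple already matches `z` at `x`.
  refine ⟨Z, -(fun y ↦ φ y (Z y)) + η x z.2 • ξ, hZ,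
    (hS.smooth_φ.apply hZ).neg.add (hS.smooth_ξ.const_smul _), fun y ↦ ?_, ?_⟩
  · simp [reebEigen, hS.eta_phi, hS.eta_xi, hS.phi_sq, hS.phi_xi, sub_eq_add_neg, add_comm]
  · refine Prod.ext hZx ?_
    simp [hZx, hz.1]

theorem hasSections_eigen [FiniteDimensional ℝ E] [T2Space M] (hS : IsSasakian φ ξ η g) :
    HasSections (eigen φ) := by
  intro x z hz
  obtain ⟨Z, hZ, hZx⟩ := exists_smoothVF_eq x z.2
  -- The field `φZ - iφ²Z` lies in the eigenspace for every `Z`, because `φ³ = -φ`. Extending the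
  -- imaginary part of `z` recovers `z` at `x`.
  refine ⟨fun y ↦ φ y (Z y), -(fun y ↦ φ y (φ y (Z y))), hS.smooth_φ.apply hZ,
    (hS.smooth_φ.apply (hS.smooth_φ.apply hZ)).neg, fun y ↦ ?_, ?_⟩
  · simp [eigen, hS.phi_cube]
  · refine Prod.ext ?_ ?_
    · simp [hZx, hz.2]
    · simp [hZx, hz.1, hz.2]

/-- The Leibniz term, in which `W` differentiates `f`, is a multiple of `ξ` and is killed by `φ`. -/
theorem phi_bracket_add_smul_left [CompleteSpace E] (hS : IsSasakian φ ξ η g)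
    {U : Π x : M, Tan E x} (W : Π x : M, Tan E x) {f : M → ℝ} (hU : SmoothVF U)
    (hf : ContMDiff 𝓘(ℝ, E) 𝓘(ℝ, ℝ) ∞ f) (x : M) :
    φ x (VectorField.mlieBracket 𝓘(ℝ, E) (fun y ↦ -U y + f y • ξ y) W x) =
      -φ x (VectorField.mlieBracket 𝓘(ℝ, E) U W x)
        + f x • φ x (VectorField.mlieBracket 𝓘(ℝ, E) ξ W x) := by
  have := isManifold_two E M
  have h : (fun y ↦ -U y + f y • ξ y) = (-1 : ℝ) • U + f • ξ := by
    funext y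
    simp
  rw [h, VectorField.mlieBracket_add_left ((hU.const_smul _).mdifferentiableAt x)
    ((hS.smooth_ξ.smul hf).mdifferentiableAt x),
    VectorField.mlieBracket_const_smul_left (hU.mdifferentiableAt x),
    VectorField.mlieBracket_smul_left ((hf x).mdifferentiableAt (by simp))
    (hS.smooth_ξ.mdifferentiableAt x)]
  simp [hS.phi_xi]

theorem phi_bracket_add_smul_right [CompleteSpace E] (hS : IsSasakian φ ξ η g)
    {U : Π x : M, Tan E x} (W : Π x : M, Tan E x) {f : M → ℝ} (hU : SmoothVF U)
    (hf : ContMDiff 𝓘(ℝ, E) 𝓘(ℝ, ℝ) ∞ f) (x : M) :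
    φ x (VectorField.mlieBracket 𝓘(ℝ, E) W (fun y ↦ -U y + f y • ξ y) x) =
      -φ x (VectorField.mlieBracket 𝓘(ℝ, E) W U x)
        - f x • φ x (VectorField.mlieBracket 𝓘(ℝ, E) ξ W x) := by
  rw [VectorField.mlieBracket_swap_apply, map_neg, hS.phi_bracket_add_smul_left W hU hf,
    VectorField.mlieBracket_swap_apply (V := W), map_neg]
  module

theorem phi_nijenhuis (hS : IsSasakian φ ξ η g) {X Y : Π x : M, Tan E x}
    (hX : SmoothVF X) (hY : SmoothVF Y) (x : M) : φ x (nijenhuis φ X Y x) = 0 := by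
  have h := congrArg (φ x) (hS.normal X Y hX hY x)
  simpa [hS.phi_xi] using h

/-- The Reeb field preserves `φ`. -/
theorem phi_bracket_xi (hS : IsSasakian φ ξ η g) {Y : Π x : M, Tan E x} (hY : SmoothVF Y) (x : M) :
    φ x (VectorField.mlieBracket 𝓘(ℝ, E) ξ (fun y ↦ φ y (Y y)) x) =
      φ x (φ x (VectorField.mlieBracket 𝓘(ℝ, E) ξ Y x)) := by
  have h := hS.normal ξ Y hS.smooth_ξ hY x
  have h0 : (fun y ↦ φ y (ξ y)) = 0 := funext hS.phi_xi
  -- Here `dη(ξ, φ-free argument)` vanishes as `2η(φY)`, and `φξ = 0` removes two of the four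
  -- torsion terms.
  rw [hS.contact_metric, g.symm, hS.metric_xi, hS.eta_phi, nijenhuis, h0,
    VectorField.mlieBracket_zero_left, VectorField.mlieBracket_zero_left] at h
  simp only [Pi.zero_apply, map_zero, mul_zero, zero_smul, add_zero, sub_zero] at h
  exact (sub_eq_zero.1 h).symm

/-- Substitute `φX₁ = -X₂ + η(X₂)ξ` and `φY₁ = -Y₂ + η(Y₂)ξ` into `φ` of the torsion of `X₁` and
`Y₁`. The terms with `ξ` cancel by `phi_bracket_xi`, leaving `φ(Re) = φ²(Im)` for the complex
bracket. -/
theorem bracketClosed_reebEigen [CompleteSpace E] (hS : IsSasakian φ ξ η g) :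
    BracketClosed (reebEigen φ ξ η) := by
  intro X₁ X₂ Y₁ Y₂ hX₁ hX₂ hY₁ hY₂ hX hY x
  have eX : (fun y ↦ φ y (X₁ y)) = fun y ↦ -X₂ y + η y (X₂ y) • ξ y := funext fun y ↦ (hX y).1
  have eY : (fun y ↦ φ y (Y₁ y)) = fun y ↦ -Y₂ y + η y (Y₂ y) • ξ y := funext fun y ↦ (hY y).1
  have fX := hS.smooth_η.apply hX₂
  have fY := hS.smooth_η.apply hY₂
  have hN := hS.phi_nijenhuis hX₁ hY₁ x
  have h1 := hS.phi_bracket_xi hX₁ x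
  have h2 := hS.phi_bracket_xi hY₁ x
  have h3 : φ x (VectorField.mlieBracket 𝓘(ℝ, E) (fun y ↦ φ y (X₁ y)) (fun y ↦ φ y (Y₁ y)) x) =
      φ x (VectorField.mlieBracket 𝓘(ℝ, E) X₂ Y₂ x)
        + η x (Y₂ x) • φ x (VectorField.mlieBracket 𝓘(ℝ, E) ξ X₂ x)
        + η x (X₂ x) • φ x (φ x (VectorField.mlieBracket 𝓘(ℝ, E) ξ Y₁ x)) := by
    rw [← h2, eX, hS.phi_bracket_add_smul_left _ hX₂ fX, eY,
      hS.phi_bracket_add_smul_right X₂ hY₂ fY]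
    module
  have h4 : φ x (VectorField.mlieBracket 𝓘(ℝ, E) (fun y ↦ φ y (X₁ y)) Y₁ x) =
      -φ x (VectorField.mlieBracket 𝓘(ℝ, E) X₂ Y₁ x)
        + η x (X₂ x) • φ x (VectorField.mlieBracket 𝓘(ℝ, E) ξ Y₁ x) := by
    rw [eX, hS.phi_bracket_add_smul_left _ hX₂ fX]
  have h5 : φ x (VectorField.mlieBracket 𝓘(ℝ, E) X₁ (fun y ↦ φ y (Y₁ y)) x) =
      -φ x (VectorField.mlieBracket 𝓘(ℝ, E) X₁ Y₂ x)
        - η x (Y₂ x) • φ x (VectorField.mlieBracket 𝓘(ℝ, E) ξ X₁ x) := by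
    rw [eY, hS.phi_bracket_add_smul_right _ hY₂ fY]
  rw [eX, hS.phi_bracket_add_smul_right _ hX₂ fX, VectorField.mlieBracket_self] at h1
  simp only [Pi.zero_apply, map_zero, smul_zero, sub_zero] at h1
  simp only [nijenhuis, map_add, map_sub, hS.phi_cube, h3, h4, h5, map_neg, map_smul, ← h1] at hN
  have key : φ x (complexBracket X₁ X₂ Y₁ Y₂ x).1 = φ x (φ x (complexBracket X₁ X₂ Y₁ Y₂ x).2) := by
    simp only [complexBracket, map_add, map_sub]
    rw [← sub_eq_zero, ← neg_eq_zero, ← hN]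
    module
  refine ⟨key.trans (hS.phi_sq _ _), ?_⟩
  -- The second defining equation follows from `key` by one more `φ`, since `φ³ = -φ`.
  have h := congrArg (φ x) key
  rw [hS.phi_cube, hS.phi_sq] at h
  rw [← neg_inj, ← h]
  abel

theorem eta_eq_zero_of_mem_eigen (hS : IsSasakian φ ξ η g) {x : M} {z : Tan E x × Tan E x}
    (hz : z ∈ eigen φ x) : η x z.1 = 0 ∧ η x z.2 = 0 := by
  refine ⟨hz.2 ▸ hS.eta_phi x _, ?_⟩
  rw [← neg_eq_zero, ← map_neg, ← hz.1, hS.eta_phi]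

theorem mem_eigen_iff (hS : IsSasakian φ ξ η g) {x : M} {z : Tan E x × Tan E x} :
    z ∈ eigen φ x ↔ z ∈ reebEigen φ ξ η x ∧ η x z.1 = 0 ∧ η x z.2 = 0 := by
  refine ⟨fun h ↦ ?_, fun ⟨h, h1, h2⟩ ↦ ?_⟩
  · have h0 := hS.eta_eq_zero_of_mem_eigen h
    refine ⟨?_, h0⟩
    simpa [reebEigen, eigen, h0.1, h0.2] using h
  · simpa [reebEigen, eigen, h1, h2] using h

theorem eta_bracket [CompleteSpace E] (hS : IsSasakian φ ξ η g) {X Y : Π x : M, Tan E x}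
    (hX : SmoothVF X) (hY : SmoothVF Y) (hX0 : ∀ x, η x (X x) = 0) (hY0 : ∀ x, η x (Y x) = 0)
    (x : M) : η x (VectorField.mlieBracket 𝓘(ℝ, E) X Y x) = -(2 * g.inner x (X x) (φ x (Y x))) := by
  have h := extD_eq hS.smooth_η hX hY x
  simp only [hX0, hY0, dFun_const, hS.contact_metric] at h
  simp only [_root_.zero_apply] at h
  linarith

/-- By `mem_eigen_iff` only `η` of the bracket is left to check. By `eta_bracket` it is `-2g(X,
φY)`, extended complex bilinearly, and this vanishes because the skewness of `φ` makes the
`√-1`-eigenspace isotropic for `g`. -/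
theorem bracketClosed_eigen [CompleteSpace E] (hS : IsSasakian φ ξ η g) :
    BracketClosed (eigen φ) := by
  intro X₁ X₂ Y₁ Y₂ hX₁ hX₂ hY₁ hY₂ hX hY x
  have zX := fun y ↦ hS.eta_eq_zero_of_mem_eigen (hX y)
  have zY := fun y ↦ hS.eta_eq_zero_of_mem_eigen (hY y)
  refine hS.mem_eigen_iff.2 ⟨hS.bracketClosed_reebEigen _ _ _ _ hX₁ hX₂ hY₁ hY₂
    (fun y ↦ (hS.mem_eigen_iff.1 (hX y)).1) (fun y ↦ (hS.mem_eigen_iff.1 (hY y)).1) x, ?_, ?_⟩ <;>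
  simp only [complexBracket, map_sub, map_add,
    hS.eta_bracket hX₁ hY₁ (fun y ↦ (zX y).1) (fun y ↦ (zY y).1),
    hS.eta_bracket hX₁ hY₂ (fun y ↦ (zX y).1) (fun y ↦ (zY y).2),
    hS.eta_bracket hX₂ hY₁ (fun y ↦ (zX y).2) (fun y ↦ (zY y).1),
    hS.eta_bracket hX₂ hY₂ (fun y ↦ (zX y).2) (fun y ↦ (zY y).2)]
  · have h := hS.metric_skew x (X₂ x) (Y₂ x)
    rw [(hY x).2, (hX x).2] at h
    rw [(hY x).1, (hY x).2, map_neg]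
    dsimp only at h ⊢
    linarith
  · have h := hS.metric_skew x (X₂ x) (Y₁ x)
    rw [(hY x).1, (hX x).2, map_neg] at h
    rw [(hY x).1, (hY x).2, map_neg]
    dsimp only at h ⊢
    linarith

/-- Eigenvectors of `-φ*` vanish on `ξ`, so adding the line of `ξ` to the vector part keeps the two
parts annihilating each other. -/
theorem bundleL_ofVF (hS : IsSasakian φ ξ η g) (x : M) :
    bundleL (diagEndo φ x) (ofVF ξ x) = diracSet (reebEigen φ ξ η x) := by
  ext w
  constructor
  · rintro ⟨a, b, ⟨⟨U₁, α₁⟩, U₂, α₂⟩, ⟨h1, h2⟩, rfl⟩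
    obtain ⟨h1, k1⟩ := Prod.ext_iff.1 h1
    obtain ⟨h2, k2⟩ := Prod.ext_iff.1 h2
    simp only [diagEndo, LinearMap.coe_mk, AddHom.coe_mk, Prod.fst_neg, Prod.snd_neg] at h1 h2 k1 k2
    obtain ⟨e1, e2⟩ := hS.eta_eq_zero_of_mem_eigen (z := (U₁, U₂)) ⟨h1, h2⟩
    replace k1 : ∀ v, α₁ (φ x v) = α₂ v := fun v ↦ neg_injective (DFunLike.congr_fun k1 v)
    replace k2 : ∀ v, -α₂ (φ x v) = α₁ v := fun v ↦ DFunLike.congr_fun k2 v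
    have z1 : α₁ (ξ x) = 0 := by rw [← k2, hS.phi_xi, map_zero, neg_zero]
    have z2 : α₂ (ξ x) = 0 := by rw [← k1, hS.phi_xi, map_zero]
    refine ⟨⟨?_, ?_⟩, fun z hz ↦ ⟨?_, ?_⟩⟩
    · simp only [ofVF, Prod.fst_add, Prod.smul_fst, Prod.snd_add, map_add, map_smul, hS.phi_xi, h1,
        e2, hS.eta_xi, smul_eq_mul]
      module
    · simp only [ofVF, Prod.fst_add, Prod.smul_fst, Prod.snd_add, map_add, map_smul, hS.phi_xi, h2,
        e1, hS.eta_xi, smul_eq_mul]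
      module
    · simp [ofVF, ← k2, hz.1, z2]
    · simp [ofVF, ← k2, hz.2, z2]
  · rintro ⟨⟨h1, h2⟩, h⟩
    refine ⟨η x w.1.1, η x w.2.1, (w.1 - η x w.1.1 • ofVF ξ x, w.2 - η x w.2.1 • ofVF ξ x),
      ⟨?_, ?_⟩, by simp⟩
    all_goals
      refine Prod.ext ?_ (ContinuousLinearMap.ext fun v ↦ ?_)
    · simp only [diagEndo, LinearMap.coe_mk, AddHom.coe_mk, Prod.fst_neg, ofVF, Prod.fst_sub,
        Prod.smul_fst, map_sub, map_smul, hS.phi_xi, h1]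
      module
    · have k := (h (v, -φ x v) ⟨by simp [hS.eta_phi], by simp [hS.phi_sq, sub_eq_add_neg, add_comm]⟩).2
      simp only [map_neg, neg_inj] at k
      simp [diagEndo, ofVF, k]
    · simp only [diagEndo, LinearMap.coe_mk, AddHom.coe_mk, ofVF, Prod.fst_sub,
        Prod.smul_fst, map_sub, map_smul, hS.phi_xi, h2]
      module
    · have k := (h (v, -φ x v) ⟨by simp [hS.eta_phi], by simp [hS.phi_sq, sub_eq_add_neg, add_comm]⟩).1
      simp only [map_neg] at k
      simp [diagEndo, ofVF, k]

/-- Dual situation: `η` vanishes on the eigenspace, so its line enlarges the annihilator. The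
coefficient of `η` is read off by evaluating at `ξ`. -/
theorem bundleL_ofForm (hS : IsSasakian φ ξ η g) (x : M) :
    bundleL (diagEndo φ x) (ofForm η x) = diracSet (eigen φ x) := by
  ext w
  constructor
  · rintro ⟨a, b, ⟨⟨U₁, α₁⟩, U₂, α₂⟩, ⟨h1, h2⟩, rfl⟩
    obtain ⟨h1, k1⟩ := Prod.ext_iff.1 h1
    obtain ⟨h2, k2⟩ := Prod.ext_iff.1 h2
    simp only [diagEndo, LinearMap.coe_mk, AddHom.coe_mk, Prod.fst_neg, Prod.snd_neg] at h1 h2 k1 k2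
    replace k2 : ∀ v, -α₂ (φ x v) = α₁ v := fun v ↦ DFunLike.congr_fun k2 v
    refine ⟨⟨by simpa [ofForm] using h1, by simpa [ofForm] using h2⟩, fun z hz ↦ ?_⟩
    obtain ⟨e1, e2⟩ := hS.eta_eq_zero_of_mem_eigen hz
    constructor
    · simp [ofForm, ← k2, hz.1, e1, e2]
    · simp [ofForm, ← k2, hz.2, e1, e2]
  · rintro ⟨⟨h1, h2⟩, h⟩
    refine ⟨w.1.2 (ξ x), w.2.2 (ξ x),
      (w.1 - w.1.2 (ξ x) • ofForm η x, w.2 - w.2.2 (ξ x) • ofForm η x), ⟨?_, ?_⟩, by simp⟩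
    all_goals
      refine Prod.ext ?_ (ContinuousLinearMap.ext fun v ↦ ?_)
    · simpa [diagEndo, ofForm] using h1
    · have k := (h (φ x v, -φ x (φ x v)) ⟨by simp, by simp [hS.phi_cube]⟩).1
      simp only [map_neg, hS.phi_sq, map_add, map_smul, smul_eq_mul] at k
      simp [diagEndo, ofForm, hS.eta_phi]
      linarith
    · simpa [diagEndo, ofForm] using h2
    · have k := (h (φ x v, -φ x (φ x v)) ⟨by simp, by simp [hS.phi_cube]⟩).2
      simp only [map_neg, hS.phi_sq, map_add, map_smul, smul_eq_mul] at k
      simp [diagEndo, ofForm, hS.eta_phi]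
      linarith

end IsSasakian

/-! ### The endomorphism of a Riemannian metric -/

section Metric

variable [FiniteDimensional ℝ E]

theorem flat_apply (g : Metric E M) (x : M) (v w : Tan E x) : flat g x v w = g.inner x v w := rfl

theorem inner_flat_symm (g : Metric E M) (x : M) (α : Cot E x) (v : Tan E x) :
    g.inner x ((flat g x).symm α) v = α v := by
  rw [← flat_apply, LinearEquiv.apply_symm_apply]

theorem smoothForm_flat (g : Metric E M) {X : Π x : M, Tan E x} (hX : SmoothVF X) :
    SmoothForm (fun x ↦ flat g x (X x)) :=
  ContMDiff.clm_bundle_apply (E₂ := fun x : M ↦ Tan E x →L[ℝ] ℝ) g.contMDiff hX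

/-- The continuous linear isomorphism `v ↦ g(v, ·)`. -/
def flatL (g : Metric E M) (x : M) : Tan E x ≃L[ℝ] Cot E x :=
  have : FiniteDimensional ℝ (Tan E x) := inferInstanceAs (FiniteDimensional ℝ E)
  have : T2Space (Tan E x) := inferInstanceAs (T2Space E)
  have : FiniteDimensional ℝ (Cot E x) :=
    (LinearMap.toContinuousLinearMap : (Tan E x →ₗ[ℝ] ℝ) ≃ₗ[ℝ] Cot E x).finiteDimensional
  (flat g x).toContinuousLinearEquiv

/-- In coordinates `g⁻¹` is the inverse of the matrix of `g`, and inversion of continuous linear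
maps is smooth at an invertible one. -/
theorem smoothVF_flat_symm (g : Metric E M) {α : Π x : M, Cot E x} (hα : SmoothForm α) :
    SmoothVF (fun x ↦ (flat g x).symm (α x)) := by
  intro x
  have hg := ((contMDiffAt_hom_bundle (E₂ := fun x : M ↦ Tan E x →L[ℝ] ℝ) _).1 (g.contMDiff x)).2
  refine ContMDiffAt.clm_apply_of_inCoordinates (E₁ := fun x : M ↦ Tan E x →L[ℝ] ℝ)
    (b₁ := id) (b₂ := id) (ϕ := fun y ↦ ((flatL g y).symm : Cot E y →L[ℝ] Tan E y))
    ?_ (hα x) contMDiffAt_id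
  have hx : ∀ᶠ y in nhds x, y ∈ (trivializationAt E (fun x : M ↦ Tan E x) x).baseSet :=
    (trivializationAt E (fun x : M ↦ Tan E x) x).open_baseSet.mem_nhds
      (mem_baseSet_trivializationAt E (fun x : M ↦ Tan E x) x)
  have hx' : ∀ᶠ y in nhds x,
      y ∈ (trivializationAt (E →L[ℝ] ℝ) (fun x : M ↦ Tan E x →L[ℝ] ℝ) x).baseSet :=
    (trivializationAt (E →L[ℝ] ℝ) (fun x : M ↦ Tan E x →L[ℝ] ℝ) x).open_baseSet.mem_nhds
      (mem_baseSet_trivializationAt (E →L[ℝ] ℝ) (fun x : M ↦ Tan E x →L[ℝ] ℝ) x)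
  have hinv : ∀ᶠ y in nhds x, ∃ e : E ≃L[ℝ] (E →L[ℝ] ℝ),
      ContinuousLinearMap.inCoordinates E (fun x : M ↦ Tan E x) (E →L[ℝ] ℝ)
        (fun x : M ↦ Tan E x →L[ℝ] ℝ) x y x y (g.inner y) = e ∧
      ContinuousLinearMap.inCoordinates (E →L[ℝ] ℝ) (fun x : M ↦ Tan E x →L[ℝ] ℝ) E
        (fun x : M ↦ Tan E x) x y x y (flatL g y).symm = (e.symm : (E →L[ℝ] ℝ) →L[ℝ] E) := by
    filter_upwards [hx, hx'] with y hy hy'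
    rw [ContinuousLinearMap.inCoordinates_eq hy hy', ContinuousLinearMap.inCoordinates_eq hy' hy]
    refine ⟨((Trivialization.continuousLinearEquivAt ℝ _ y hy).symm.trans (flatL g y)).trans
      (Trivialization.continuousLinearEquivAt ℝ _ y hy'), rfl, rfl⟩
  obtain ⟨e, he, -⟩ := hinv.self_of_nhds
  have hc : ContDiffAt ℝ ∞ (ContinuousLinearMap.inverse : (E →L[ℝ] E →L[ℝ] ℝ) → _)
      (ContinuousLinearMap.inCoordinates E (fun x : M ↦ Tan E x) (E →L[ℝ] ℝ)
        (fun x : M ↦ Tan E x →L[ℝ] ℝ) x x x x (g.inner x)) := by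
    rw [he]
    exact contDiffAt_map_inverse e
  refine (hc.contMDiffAt.comp x hg).congr_of_eventuallyEq ?_
  filter_upwards [hinv] with y ⟨e, he, he'⟩
  refine he'.trans ?_
  rw [← ContinuousLinearMap.inverse_equiv, ← he]
  rfl

theorem metricEndo_apply (g : Metric E M) (x : M) (u : BigTan E x) :
    metricEndo g x u = ((flat g x).symm u.2, flat g x u.1) := rfl

theorem isGenMetric_metricEndo (g : Metric E M) : IsGenMetric (metricEndo g) where
  smooth_G s hs := ⟨smoothVF_flat_symm g hs.2, smoothForm_flat g hs.1⟩
  selfAdjoint x u v := by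
    have h : ∀ α β : Cot E x, β ((flat g x).symm α) = α ((flat g x).symm β) := fun α β ↦ by
      rw [← inner_flat_symm g x β, g.symm, inner_flat_symm]
    simp only [pairing, metricEndo_apply, flat_apply]
    rw [h u.2 v.2, g.symm x u.1]
    ring
  sq x u := by simp [metricEndo_apply]
  pos x u hu := by
    have nonneg : ∀ v : Tan E x, 0 ≤ g.inner x v v := fun v ↦ by
      rcases eq_or_ne v 0 with rfl | h
      · simp
      · exact (g.pos x v h).le
    simp only [pairing, metricEndo_apply, flat_apply]
    -- Writing `α(g⁻¹α)` as `g(g⁻¹α, g⁻¹α)` turns the pairing into half a sum of two squared norms.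
    rw [← inner_flat_symm g x u.2 ((flat g x).symm u.2)]
    rcases eq_or_ne u.1 0 with h1 | h1
    · have h2 : (flat g x).symm u.2 ≠ 0 := fun h ↦
        hu (Prod.ext h1 ((LinearEquiv.map_eq_zero_iff _).1 h))
      linarith [nonneg u.1, g.pos x _ h2]
    · linarith [nonneg ((flat g x).symm u.2), g.pos x _ h1]

end Metric

/-! ### The generalized structure of a Sasakian structure -/

namespace IsSasakian

variable {φ : Π x : M, Tan E x →L[ℝ] Tan E x} {ξ : Π x : M, Tan E x} {η : Π x : M, Cot E x}
  {g : Metric E M}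

omit [IsManifold 𝓘(ℝ, E) ∞ M] in
theorem diagEndo_apply (φ : Π x : M, Tan E x →L[ℝ] Tan E x) (x : M) (u : BigTan E x) :
    diagEndo φ x u = (φ x u.1, -(u.2.comp (φ x))) := rfl

theorem isGenAlmostContact (hS : IsSasakian φ ξ η g) :
    IsGenAlmostContact (diagEndo φ) (ofVF ξ) (ofForm η) where
  smooth_Φ s hs := ⟨hS.smooth_φ.apply hs.1, (hs.2.comp hS.smooth_φ).neg⟩
  smooth_Ep := ⟨hS.smooth_ξ, smoothForm_zero⟩
  smooth_Em := ⟨smoothVF_zero, hS.smooth_η⟩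
  skew x u v := by
    simp [pairing, diagEndo_apply]
    ring
  sq x u := by
    refine Prod.ext ?_ (ContinuousLinearMap.ext fun v ↦ ?_)
    · simp [pairing, diagEndo_apply, ofVF, ofForm, hS.phi_sq]
    · simp [pairing, diagEndo_apply, ofVF, ofForm, hS.phi_sq]
      ring
  isotropic_Ep x := by simp [pairing, ofVF]
  isotropic_Em x := by simp [pairing, ofForm]
  dual x := by simp [pairing, ofVF, ofForm, hS.eta_xi]

theorem isStrong [FiniteDimensional ℝ E] [T2Space M] (hS : IsSasakian φ ξ η g) :
    IsStrong (diagEndo φ) (ofVF ξ) (ofForm η) := by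
  have := FiniteDimensional.complete ℝ E
  constructor
  · simp only [hS.bundleL_ofVF]
    exact involutive_diracSet hS.bracketClosed_reebEigen hS.hasSections_reebEigen
  · simp only [hS.bundleL_ofForm]
    exact involutive_diracSet hS.bracketClosed_eigen hS.hasSections_eigen

/-- The form part is `ι_ξ dη` plus a multiple of `d(η(ξ))`: the first is zero since `dη(ξ, v) =
2η(φv)`, the second since `η(ξ)` is constant. -/
theorem courant_ofVF_ofForm (hS : IsSasakian φ ξ η g) (x : M) :
    courant (ofVF ξ) (ofForm η) x = 0 := by
  refine Prod.ext ?_ ?_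
  · exact congrFun (VectorField.mlieBracket_zero_right (I := 𝓘(ℝ, E)) (W := ξ)) x
  · rw [courant_snd hS.isGenAlmostContact.smooth_Ep hS.isGenAlmostContact.smooth_Em]
    have h : extD η x (ξ x) = 0 := by
      ext v
      simp [hS.contact_metric, g.symm x (ξ x), hS.metric_xi, hS.eta_phi]
    simp only [ofVF, ofForm, h, hS.eta_xi, dFun_const, map_zero, sub_zero, smul_zero, add_zero]
    rfl

theorem metric_compat_endo [FiniteDimensional ℝ E] (hS : IsSasakian φ ξ η g) (x : M)
    (u : BigTan E x) :
    -diagEndo φ x (metricEndo g x (diagEndo φ x u)) =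
      metricEndo g x u - (2 * pairing (ofVF ξ x) u) • ofVF ξ x
        - (2 * pairing (ofForm η x) u) • ofForm η x := by
  -- Skewness of `φ` means that `g⁻¹` intertwines `φ*` with `-φ`.
  have h : (flat g x).symm (u.2.comp (φ x)) = -φ x ((flat g x).symm u.2) := by
    rw [LinearEquiv.symm_apply_eq]
    ext v
    rw [flat_apply, map_neg, _root_.neg_apply, hS.metric_skew, neg_neg, inner_flat_symm]
    rfl
  have hξ : u.2 (ξ x) = η x ((flat g x).symm u.2) := by
    rw [← inner_flat_symm g x u.2, hS.metric_xi]
  refine Prod.ext ?_ (ContinuousLinearMap.ext fun v ↦ ?_)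
  · simp [pairing, diagEndo_apply, metricEndo_apply, ofVF, ofForm, h, hξ, hS.phi_sq]
    abel
  · simp [pairing, diagEndo_apply, metricEndo_apply, ofVF, ofForm, flat_apply, hS.metric_compat]

omit [IsManifold 𝓘(ℝ, E) ∞ M] in
theorem etaOf_eq (ξ : Π x : M, Tan E x) (η : Π x : M, Cot E x) :
    etaOf (ofVF ξ) (ofForm η) = η := by
  funext x
  simp [etaOf, ofVF, ofForm]

/-- If `dη = 0`, then `2g(φv, φv) = dη(φv, v) = 0`, so `φ = 0`, and the formula for `φ²` reads `v =
η(v)ξ`. -/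
theorem extD_ne_zero [Nonempty M] (hS : IsSasakian φ ξ η g) (hE : 1 < Module.finrank ℝ E) :
    extD η ≠ 0 := by
  intro h0
  obtain ⟨x⟩ := ‹Nonempty M›
  have hφ : ∀ v, φ x v = 0 := fun v ↦ by
    by_contra hv
    have h := hS.contact_metric x (φ x v) v
    rw [h0] at h
    have := g.pos x _ hv
    simp at h
    linarith
  have hle : Module.finrank ℝ (Tan E x) ≤ 1 := finrank_le_one (ξ x) fun v ↦ by
    refine ⟨η x v, ?_⟩
    have h := hS.phi_sq x v
    rw [hφ, eq_comm, neg_add_eq_zero] at h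
    exact h.symm
  exact absurd hE (not_lt.2 hle)

-- The Poisson structure vanishes: `Φ` has no block from `T*M` to `TM`, and `E₋` has no vector part.
omit [IsManifold 𝓘(ℝ, E) ∞ M] in
theorem gaugeMap_eq_one (φ : Π x : M, Tan E x →L[ℝ] Tan E x) (ξ : Π x : M, Tan E x)
    (η : Π x : M, Cot E x) (t : ℝ) (x : M) :
    gaugeMap (diagEndo φ) (ofVF ξ) (ofForm η) t x = 1 := by
  have h : poissonM (diagEndo φ) (ofVF ξ) (ofForm η) x = 0 := by
    ext α
    simp [poissonM, poissonZero, wedge, evalAt, diagEndo_apply, ofVF, ofForm]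
  rw [gaugeMap, h, LinearMap.comp_zero, smul_zero, add_zero]

end IsSasakian

end GenGeom

end

theorem theorem5p3 {E : Type*} [NormedAddCommGroup E] [NormedSpace ℝ E] [FiniteDimensional ℝ E]
    {M : Type*} [TopologicalSpace M] [ChartedSpace E M] [IsManifold 𝓘(ℝ, E) ∞ M]
    [T2Space M] [SecondCountableTopology M] [Nonempty M]
    (n : ℕ) (hn : 1 ≤ n) (hE : Module.finrank ℝ E = 2 * n + 1)
    (φ : Π x : M, GenGeom.Tan E x →L[ℝ] GenGeom.Tan E x) (ξ : Π x : M, GenGeom.Tan E x)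
    (η : Π x : M, GenGeom.Cot E x) (g : GenGeom.Metric E M)
    (hS : GenGeom.IsSasakian φ ξ η g) :
    GenGeom.IsGenSasakian (GenGeom.diagEndo φ) (GenGeom.ofVF ξ) (GenGeom.ofForm η)
      (GenGeom.metricEndo g) where
  normalContactMetric := ⟨⟨hS.isGenAlmostContact, hS.isStrong, hS.courant_ofVF_ofForm⟩,
    GenGeom.isGenMetric_metricEndo g, hS.metric_compat_endo⟩
  d_eta_ne_zero := by
    rw [GenGeom.IsSasakian.etaOf_eq]
    exact hS.extD_ne_zero (by omega)
  invertible t x := by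
    rw [GenGeom.IsSasakian.gaugeMap_eq_one]
    exact isUnit_one
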